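/- **Theorem 4.1.** Let $M_0,M_1\ge 1$ and let $\{(X_n,J_n)\}$ be an M/G/1-type Markov chain: its state space is $\mathbb S=(\{0\}\times\{1,\dots,M_0\})\cup\bigcup_{k\ge1}(\{k\}\times\{1,\dots,M_1\})$ and its transition matrix $P$ is a stochastic matrix whose blocks between levels are: $B(k)$ from level $0$ to level $k\ge0$; $B(-1)$ from level $1$ to level $0$; $A(l-k)$ from level $k\ge1$ to level $l\ge1$ when $l\ge k-1$; and $O$ otherwise. Let $e$ be the column vector of ones. Assume that 1. $P$ is irreducible; 2. $A:=\sum_{k\ge-1}A(k)$ is an irreducible stochastic matrix; 3. $\sum_{k\ge1}kB(k)e<\infty$ (entrywise); 4. $\sigma:=\varpi\,\overline m_A<0$, where $\overline m_A=\sum_{k\ge-1}kA(k)e$ and $\varpi$ is the unique stationary distribution of $A$ (so, in particular, $\overline m_A$ is finite). For $N\ge1$ let $P^{(N)}$ be the level-increment truncation of $P$, i.e. the matrix of the same block form in which $A(k)$ and $B(k)$ are kept for $-1\le k\le N-1$, replaced by $\sum_{l\ge N}A(l)$ and $\sum_{l\ge N}B(l)$ for $k=N$, and replaced by $O$ for $k\ge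 N+1$. Then $P$ has a unique stationary distribution $\pi$; $P^{(N)}$ has a stationary distribution for every $N\ge1$, which is unique for all sufficiently large $N$; and, for any choice of stationary distributions $\pi^{(N)}$ of $P^{(N)}$, $N\ge1$, $$\lim_{N\to\infty}\|\pi^{(N)}-\pi\|=0,\qquad\text{where } \|x\|:=\sum_{s\in\mathbb S}|x_s|.$$ -/

import Mathlib

open Filter Topology

/-- A (possibly infinite) real matrix is stochastic: nonnegative entries, and each row sums to 1. -/
def IsStochastic {S : Type*} (P : Matrix S S ℝ) : Prop :=
  (∀ x y, 0 ≤ P x y) ∧ ∀ x, HasSum (fun y => P x y) 1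

/-- `μ` is a stationary distribution of `P`: a probability vector with `μ P = μ`. -/
def IsStationaryDist {S : Type*} (P : Matrix S S ℝ) (μ : S → ℝ) : Prop :=
  (∀ x, 0 ≤ μ x) ∧ HasSum μ 1 ∧ ∀ y, HasSum (fun x => μ x * P x y) (μ y)

/-- The total variation norm `‖x‖ = ∑ₛ |x s|` of a vector (meaningful for summable vectors; the
difference of two probability vectors is one). -/
noncomputable def tvNorm {S : Type*} (x : S → ℝ) : ℝ := ∑' s, |x s|

/-- The state space of an M/G/1-type chain: `Sum.inl i` is the state `(0, i)` of level `0`, with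
`M₀` phases, and `Sum.inr (n, i)` is the state `(n + 1, i)` of level `n + 1`, with `M₁` phases. -/
abbrev MG1State (M₀ M₁ : ℕ) : Type := Fin M₀ ⊕ ℕ × Fin M₁

/-- The block components of an M/G/1-type matrix.
Only the blocks `A k` with `k ≥ -1` and `Bup k` with `k ≥ 1` are ever used. -/
structure MG1Blocks (M₀ M₁ : ℕ) where
  /-- `A(k)`, `k ≥ -1`: a transition from a level `l ≥ 1` to the level `l + k ≥ 1`. -/
  A : ℤ → Matrix (Fin M₁) (Fin M₁) ℝ
  /-- `B(-1)`: a transition from level `1` to level `0`. -/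
  Bdown : Matrix (Fin M₁) (Fin M₀) ℝ
  /-- `B(0)`: a transition from level `0` to itself. -/
  Bzero : Matrix (Fin M₀) (Fin M₀) ℝ
  /-- `B(k)`, `k ≥ 1`: a transition from level `0` to level `k`. -/
  Bup : ℕ → Matrix (Fin M₀) (Fin M₁) ℝ

namespace MG1Blocks

variable {M₀ M₁ : ℕ}

/-- The upper block-Hessenberg matrix `P` with the given block components. -/
def P (D : MG1Blocks M₀ M₁) : Matrix (MG1State M₀ M₁) (MG1State M₀ M₁) ℝ
  | Sum.inl i, Sum.inl j => D.Bzero i j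
  | Sum.inl i, Sum.inr (l, j) => D.Bup (l + 1) i j
  | Sum.inr (k, i), Sum.inl j => if k = 0 then D.Bdown i j else 0
  | Sum.inr (k, i), Sum.inr (l, j) => if -1 ≤ (l : ℤ) - k then D.A ((l : ℤ) - k) i j else 0

/-- `A = ∑_{k ≥ -1} A(k)`, with `k = n - 1`. -/
noncomputable def Asum (D : MG1Blocks M₀ M₁) : Matrix (Fin M₁) (Fin M₁) ℝ :=
  Matrix.of fun i j => ∑' n : ℕ, D.A ((n : ℤ) - 1) i j

/-- The `i`-th entry of `k A(k) e`, the term of index `k = n - 1 ≥ -1` of the mean drift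
vector `m_A`. -/
def driftTerm (D : MG1Blocks M₀ M₁) (i : Fin M₁) (n : ℕ) : ℝ :=
  ((n : ℝ) - 1) * ∑ j, D.A ((n : ℤ) - 1) i j

/-- The mean drift vector `m_A = ∑_{k ≥ -1} k A(k) e`. -/
noncomputable def mA (D : MG1Blocks M₀ M₁) (i : Fin M₁) : ℝ := ∑' n : ℕ, D.driftTerm i n

/-- The standing assumption on an M/G/1-type chain. -/
structure BasicAssumption (D : MG1Blocks M₀ M₁) : Prop where
  stochastic : IsStochastic D.P
  irreducible : D.P.IsIrreducible
  stochastic_A : IsStochastic D.Asum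
  irreducible_A : D.Asum.IsIrreducible
  /-- `m_B = ∑_{k ≥ 1} k B(k) e < ∞`; the term `k = 0` vanishes. -/
  mB_finite : ∀ i, Summable fun k : ℕ => (k : ℝ) * ∑ j, D.Bup k i j
  /-- The negative mean drift `σ = ϖ m_A < 0`, where `ϖ` is the (unique) stationary
  distribution of `A`.  As `ϖ` has positive entries, `σ < 0` includes that `m_A` is finite. -/
  mA_finite : ∀ i, Summable (D.driftTerm i)
  drift_neg : ∃ ϖ : Fin M₁ → ℝ, IsStationaryDist D.Asum ϖ ∧ ∑ i, ϖ i * D.mA i < 0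

/-- The level-increment truncation at `N ≥ 1`: the blocks `A(k)`, `B(k)` are kept for `k < N`,
replaced by the tail sums `∑_{l ≥ N} A(l)`, `∑_{l ≥ N} B(l)` for `k = N`, and by zero
for `k > N`.  The blocks `B(-1)` and `B(0)` are not changed. -/
noncomputable def trunc (D : MG1Blocks M₀ M₁) (N : ℕ) : MG1Blocks M₀ M₁ where
  A k := if k < (N : ℤ) then D.A k
    else if k = (N : ℤ) then Matrix.of fun i j => ∑' m : ℕ, D.A ((N : ℤ) + m) i j
    else 0
  Bdown := D.Bdown
  Bzero := D.Bzero
  Bup k := if k < N then D.Bup k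
    else if k = N then Matrix.of fun i j => ∑' m : ℕ, D.Bup (N + m) i j
    else 0

end MG1Blocks

/-! The proof is a Foster–Lyapunov argument in which one drift identity excludes loss of mass. Put
`V = 0` on level 0 and `V = k + a i` on phase `i` of level `k + 1`, where `a` solves the Poisson
equation of `A` with right-hand side the mean drift vector. The phase correction makes the drift `P
V - V` equal to `σ = -ε` at every state above level 1. Hence `P V - V = g - ε` with `g` supported on
the finite set `C` of states of levels 0 and 1.

For the stationary `π` of `P` this gives `∑_C π g = ε`. Level-increment truncation only moves mass
to lower levels within a phase, and `V` increases with the level, so the drift under `P^(N)` is at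
most `g - ε`. Every stationary `π^(N)` therefore satisfies `∑_C π^(N) g ≥ ε`. A pointwise limit of
the `π^(N)` is an invariant measure of `P` of mass at most 1, that is `c π` with `c ≤ 1`. As `C` is
finite, the inequality survives the limit and reads `c ε ≥ ε`, so `c = 1`. Scheffé's lemma turns
pointwise convergence into convergence in norm.

The same drift bound gives existence, through Cesàro averages. It also forces every stationary
distribution of `P^(N)` to charge `C`. For large `N` a fixed state is reachable from all of `C`, and
uniqueness follows. The main lemmas are `IsStochastic.tendsto_truncated_drift`,
`tendsto_tvNorm_stationaryDist`, `IsStochastic.exists_poisson` and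
`MG1Blocks.exists_hasSum_trunc_le`. -/

/-! ### Invariant measures, compactness, and integrated drift. -/

section Markov

variable {S : Type*} {P : Matrix S S ℝ} {μ : S → ℝ}

/-- The row vector `μ P`. -/
noncomputable def vecStep (P : Matrix S S ℝ) (μ : S → ℝ) (y : S) : ℝ := ∑' x, μ x * P x y

theorem IsStochastic.le_one (hP : IsStochastic P) (x y : S) : P x y ≤ 1 :=
  le_hasSum (hP.2 x) y fun z _ => hP.1 x z

theorem IsStochastic.summable_mul (hP : IsStochastic P) (hμ : ∀ x, 0 ≤ μ x) (hs : Summable μ)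
    (y : S) : Summable fun x => μ x * P x y :=
  hs.of_nonneg_of_le (fun x => mul_nonneg (hμ x) (hP.1 x y)) fun x =>
    mul_le_of_le_one_right (hμ x) (hP.le_one x y)

theorem IsStochastic.hasSum_vecStep (hP : IsStochastic P) (hμ : ∀ x, 0 ≤ μ x) (hs : Summable μ)
    (y : S) : HasSum (fun x => μ x * P x y) (vecStep P μ y) :=
  (hP.summable_mul hμ hs y).hasSum

theorem IsStochastic.vecStep_nonneg (hP : IsStochastic P) (hμ : ∀ x, 0 ≤ μ x) (y : S) :
    0 ≤ vecStep P μ y :=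
  tsum_nonneg fun x => mul_nonneg (hμ x) (hP.1 x y)

/-- `(μ P) f = μ (P f)` for nonnegative `μ` and `f`. -/
theorem IsStochastic.hasSum_vecStep_mul (hP : IsStochastic P) (hμ : ∀ x, 0 ≤ μ x)
    (hs : Summable μ) {f G : S → ℝ} {s : ℝ} (hf : ∀ x, 0 ≤ f x)
    (hG : ∀ x, HasSum (fun y => P x y * f y) (G x)) (hsum : HasSum (fun x => μ x * G x) s) :
    HasSum (fun y => vecStep P μ y * f y) s := by
  have h1 : ∀ x, HasSum (fun y => μ x * (P x y * f y)) (μ x * G x) := fun x =>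
    (hG x).mul_left (μ x)
  have hF : Summable fun p : S × S => μ p.1 * (P p.1 p.2 * f p.2) := by
    refine (summable_prod_of_nonneg fun p =>
      mul_nonneg (hμ _) (mul_nonneg (hP.1 _ _) (hf _))).2 ⟨fun x => (h1 x).summable, ?_⟩
    simpa only [(h1 _).tsum_eq] using hsum.summable
  have h2 : HasSum (fun p : S × S => μ p.1 * (P p.1 p.2 * f p.2)) s := by
    have := hF.hasSum
    rwa [(this.prod_fiberwise h1).unique hsum] at this
  have h3 := (Equiv.prodComm S S).hasSum_iff.2 h2
  refine h3.prod_fiberwise fun y => ?_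
  have := (hP.hasSum_vecStep hμ hs y).mul_right (f y)
  simpa [Function.comp_def, mul_assoc] using this

theorem IsStochastic.hasSum_vecStep_mass (hP : IsStochastic P) (hμ : ∀ x, 0 ≤ μ x) {m : ℝ}
    (hs : HasSum μ m) : HasSum (vecStep P μ) m := by
  have := hP.hasSum_vecStep_mul hμ hs.summable (f := fun _ => 1) (G := fun _ => 1) (s := m)
    (fun _ => zero_le_one) (fun x => by simpa using hP.2 x) (by simpa using hs)
  simpa using this

/-- Since `vecStep` preserves mass, this upgrades a one-sided comparison of `μ P` with `μ` to
invariance. -/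
theorem eq_of_hasSum_of_le {f g : S → ℝ} {s : ℝ} (hf : HasSum f s) (hg : HasSum g s)
    (h : ∀ x, f x ≤ g x) : f = g := by
  by_contra hne
  obtain ⟨x, hx⟩ := Function.ne_iff.1 hne
  exact lt_irrefl _ (hasSum_lt h (lt_of_le_of_ne (h x) hx) hf hg)

theorem IsStationaryDist.vecStep_eq (h : IsStationaryDist P μ) : vecStep P μ = μ :=
  funext fun y => (h.2.2 y).tsum_eq

/-- A finite nonzero invariant measure can be normalized to a stationary distribution. -/
theorem IsStochastic.isStationaryDist_div (hP : IsStochastic P) (hμ : ∀ x, 0 ≤ μ x) {m : ℝ}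
    (hs : HasSum μ m) (hm : 0 < m) (hinv : vecStep P μ = μ) :
    IsStationaryDist P fun x => μ x / m := by
  refine ⟨fun x => div_nonneg (hμ x) hm.le, by simpa [hm.ne'] using hs.div_const m, fun y => ?_⟩
  have := (hP.hasSum_vecStep hμ hs.summable y).div_const m
  rw [hinv] at this
  simpa [div_mul_eq_mul_div] using this

/-- The positive part of an invariant signed measure is invariant. -/
theorem IsStochastic.vecStep_posPart (hP : IsStochastic P) {d : S → ℝ} (hd : Summable d)
    (hinv : ∀ y, HasSum (fun x => d x * P x y) (d y)) :
    vecStep P (fun x => max (d x) 0) = fun x => max (d x) 0 := by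
  have hp : Summable fun x => max (d x) 0 := by
    refine hd.abs.of_nonneg_of_le (fun x => le_max_right _ _) fun x => ?_
    exact max_le (le_abs_self _) (abs_nonneg _)
  have h0 : ∀ x, 0 ≤ max (d x) 0 := fun x => le_max_right _ _
  -- `d⁺ P` dominates both `d P = d` and `0`, hence `d⁺`; the two have equal mass.
  refine (eq_of_hasSum_of_le hp.hasSum (hP.hasSum_vecStep_mass h0 hp.hasSum) fun y => ?_).symm
  refine max_le ?_ (hP.vecStep_nonneg h0 y)
  exact hasSum_le (fun x => mul_le_mul_of_nonneg_right (le_max_left _ _) (hP.1 x y)) (hinv y)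
    (hP.hasSum_vecStep h0 hp y)

/-- If all stationary distributions charge a common state then there is at most one. -/
theorem IsStochastic.stationaryDist_unique (hP : IsStochastic P) {z : S}
    (hz : ∀ μ, IsStationaryDist P μ → 0 < μ z) {μ ν : S → ℝ} (hμ : IsStationaryDist P μ)
    (hν : IsStationaryDist P ν) : μ = ν := by
  have key : ∀ {μ ν : S → ℝ}, IsStationaryDist P μ → IsStationaryDist P ν → ∀ x, ν x < μ x →
      ν z < μ z := by
    intro μ ν hμ hν x hx
    have hd : Summable fun x => μ x - ν x := hμ.2.1.summable.sub hν.2.1.summable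
    have hp : Summable fun x => max (μ x - ν x) 0 := by
      refine hd.abs.of_nonneg_of_le (fun x => le_max_right _ _) fun x => ?_
      exact max_le (le_abs_self _) (abs_nonneg _)
    have h0 : ∀ x, 0 ≤ max (μ x - ν x) 0 := fun x => le_max_right _ _
    have hinv := hP.vecStep_posPart hd fun y => by
      simpa [sub_mul] using (hμ.2.2 y).sub (hν.2.2 y)
    have hm : 0 < ∑' x, max (μ x - ν x) 0 :=
      hp.tsum_pos h0 x (lt_max_of_lt_left (sub_pos.2 hx))
    -- The normalized positive part of `μ - ν` is stationary, so it charges `z`. Exchanging `μ` and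
    -- `ν` then gives both strict inequalities at `z`.
    have := hz _ (hP.isStationaryDist_div h0 hp.hasSum hm hinv)
    have h2 : 0 < max (μ z - ν z) 0 := by
      by_contra h
      exact absurd this (not_lt.2 (div_nonpos_of_nonpos_of_nonneg (not_lt.1 h) hm.le))
    rcases lt_max_iff.1 h2 with h3 | h3
    · linarith
    · exact absurd h3 (lt_irrefl _)
  by_contra hne
  obtain ⟨x, hx⟩ := Function.ne_iff.1 hne
  have hex : ∀ {μ ν : S → ℝ}, HasSum μ 1 → HasSum ν 1 → μ ≠ ν → ∃ x, ν x < μ x := by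
    intro μ ν h1 h2 h3
    by_contra h
    push Not at h
    exact h3 (eq_of_hasSum_of_le h1 h2 h)
  obtain ⟨x, hx⟩ := hex hμ.2.1 hν.2.1 hne
  obtain ⟨y, hy⟩ := hex hν.2.1 hμ.2.1 (Ne.symm hne)
  exact lt_asymm (key hμ hν x hx) (key hν hμ y hy)

theorem IsStationaryDist.pos_of_reachable (hP : IsStochastic P) (hμ : IsStationaryDist P μ)
    {x z : S} (hx : 0 < μ x) (h : Relation.ReflTransGen (fun x y => 0 < P x y) x z) : 0 < μ z := by
  induction h with
  | refl => exact hx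
  | tail _ hbc ih =>
    exact lt_of_lt_of_le (mul_pos ih hbc)
      (le_hasSum (hμ.2.2 _) _ fun w _ => mul_nonneg (hμ.1 w) (hP.1 w _))

/-- Pointwise limits of almost invariant probability vectors are invariant measures. -/
theorem IsStochastic.invariant_of_tendsto (hP : IsStochastic P) {ι : Type*} {l : Filter ι}
    [l.NeBot] {Q : ι → Matrix S S ℝ} {ν : ι → S → ℝ} (hQ : ∀ᶠ n in l, IsStochastic (Q n))
    (hν : ∀ᶠ n in l, (∀ x, 0 ≤ ν n x) ∧ HasSum (ν n) 1)
    (hQP : ∀ x y, Tendsto (fun n => Q n x y) l (𝓝 (P x y)))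
    (hνμ : ∀ x, Tendsto (fun n => ν n x) l (𝓝 (μ x)))
    (hinv : ∀ y, Tendsto (fun n => vecStep (Q n) (ν n) y - ν n y) l (𝓝 0)) :
    (∀ x, 0 ≤ μ x) ∧ Summable μ ∧ ∑' x, μ x ≤ 1 ∧ vecStep P μ = μ := by
  have h0 : ∀ x, 0 ≤ μ x := fun x =>
    ge_of_tendsto (hνμ x) (hν.mono fun n hn => hn.1 x)
  have hfin : ∀ F : Finset S, ∑ x ∈ F, μ x ≤ 1 := fun F =>
    le_of_tendsto (tendsto_finsetSum F fun x _ => hνμ x) (hν.mono fun n hn =>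
      sum_le_hasSum F (fun x _ => hn.1 x) hn.2)
  have hs : Summable μ := summable_of_sum_le h0 hfin
  refine ⟨h0, hs, hs.tsum_le_of_sum_le hfin, ?_⟩
  -- Passing to the limit in finite partial sums, as in Fatou's lemma, yields only `μ P ≤ μ`;
  -- conservation of mass gives equality.
  refine eq_of_hasSum_of_le (hP.hasSum_vecStep_mass h0 hs.hasSum) hs.hasSum fun y => ?_
  refine (hP.summable_mul h0 hs y).tsum_le_of_sum_le fun F => ?_
  have h1 : Tendsto (fun n => ∑ x ∈ F, ν n x * Q n x y) l (𝓝 (∑ x ∈ F, μ x * P x y)) :=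
    tendsto_finsetSum F fun x _ => (hνμ x).mul (hQP x y)
  have h2 : Tendsto (fun n => vecStep (Q n) (ν n) y) l (𝓝 (μ y)) := by
    simpa using (hinv y).add (hνμ y)
  refine le_of_tendsto_of_tendsto h1 h2 ?_
  filter_upwards [hQ, hν] with n hn hn'
  exact sum_le_hasSum F (fun x _ => mul_nonneg (hn'.1 x) (hn.1 x y))
    (hn.hasSum_vecStep hn'.1 hn'.2.summable y)

/-- Tychonoff's theorem on `[0, 1]^S`. Ultrafilters replace diagonal subsequences, and mass may be
lost in the limit. -/
theorem exists_tendsto_ultrafilter {ι : Type*} (U : Ultrafilter ι) {ν : ι → S → ℝ}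
    (hν : ∀ᶠ n in (U : Filter ι), (∀ x, 0 ≤ ν n x) ∧ HasSum (ν n) 1) :
    ∃ μ : S → ℝ, ∀ x, Tendsto (fun n => ν n x) U (𝓝 (μ x)) := by
  have hK : IsCompact (Set.pi Set.univ fun _ : S => Set.Icc (0 : ℝ) 1) :=
    isCompact_univ_pi fun _ => isCompact_Icc
  have hU : ((U.map ν : Ultrafilter (S → ℝ)) : Filter (S → ℝ)) ≤
      𝓟 (Set.pi Set.univ fun _ : S => Set.Icc (0 : ℝ) 1) := by
    rw [le_principal_iff, Ultrafilter.coe_map, mem_map]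
    filter_upwards [hν] with n hn x _
    exact ⟨hn.1 x, le_hasSum hn.2 x fun y _ => hn.1 y⟩
  obtain ⟨μ, -, hμ⟩ := hK.ultrafilter_le_nhds _ hU
  refine ⟨μ, tendsto_pi_nhds.1 ?_⟩
  simpa [Tendsto] using hμ

/-- Scheffé's lemma for probability vectors. -/
theorem tendsto_tvNorm_sub {ν : ℕ → S → ℝ} (hμ : ∀ x, 0 ≤ μ x) (hμ1 : HasSum μ 1)
    (hν : ∀ᶠ n in atTop, (∀ x, 0 ≤ ν n x) ∧ HasSum (ν n) 1)
    (h : ∀ x, Tendsto (fun n => ν n x) atTop (𝓝 (μ x))) :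
    Tendsto (fun n => tvNorm (ν n - μ)) atTop (𝓝 0) := by
  have h1 : Tendsto (fun n => ∑' x, max (μ x - ν n x) 0) atTop
      (𝓝 (∑' x, max (μ x - μ x) 0)) := by
    refine tendsto_tsum_of_dominated_convergence hμ1.summable (fun x => ?_) ?_
    · exact (tendsto_const_nhds.sub (h x)).max tendsto_const_nhds
    · filter_upwards [hν] with n hn x
      rw [Real.norm_of_nonneg (le_max_right _ _)]
      exact max_le (by linarith [hn.1 x]) (hμ x)
  simp only [sub_self, max_self, tsum_zero] at h1
  have h2 : Tendsto (fun n => 2 * ∑' x, max (μ x - ν n x) 0) atTop (𝓝 0) := by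
    simpa using h1.const_mul 2
  refine h2.congr' ?_
  filter_upwards [hν] with n hn
  have hp : Summable fun x => max (μ x - ν n x) 0 :=
    hμ1.summable.of_nonneg_of_le (fun x => le_max_right _ _) fun x =>
      max_le (by linarith [hn.1 x]) (hμ x)
  -- `|ν - μ| = 2 (μ - ν)⁺ + (ν - μ)`, and the last term has total mass zero.
  have h3 : HasSum (fun x => |ν n x - μ x|) (2 * (∑' x, max (μ x - ν n x) 0) + (1 - 1)) := by
    refine ((hp.hasSum.mul_left 2).add (hn.2.sub hμ1)).congr_fun ?_
    intro x
    rcases le_total (μ x) (ν n x) with hx | hx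
    · rw [max_eq_right (by linarith), abs_of_nonneg (by linarith)]; ring
    · rw [max_eq_left (by linarith), abs_of_nonpos (by linarith)]; ring
  simpa [tvNorm] using h3.tsum_eq.symm

/-- A function with increments bounded below along transitions and bounded drift: its drift
integrates to the limit of the integrals of the drifts of its truncations. -/
theorem IsStochastic.tendsto_truncated_drift (hP : IsStochastic P) (hμ : ∀ x, 0 ≤ μ x)
    (hμs : Summable μ) {V G : S → ℝ} {δ κ : ℝ} (hδ : 0 ≤ δ) (hκ : 0 ≤ κ)
    (hV : ∀ x, 0 ≤ V x) (hG : ∀ x, HasSum (fun y => P x y * V y) (G x))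
    (hdown : ∀ x y, P x y ≠ 0 → V x - δ ≤ V y) (hup : ∀ x, G x ≤ V x + κ) :
    (Summable fun x => μ x * (G x - V x)) ∧
    Tendsto (fun n : ℕ => ∑' y, (vecStep P μ y - μ y) * min (V y) n) atTop
      (𝓝 (∑' x, μ x * (G x - V x))) := by
  -- `V` need not be `μ`-integrable, so the drift is integrated for the bounded truncations `V ∧ n`.
  let W : ℕ → S → ℝ := fun n y => min (V y) n
  have hW0 : ∀ n y, 0 ≤ W n y := fun n y => le_min (hV y) n.cast_nonneg
  have hWV : ∀ n y, W n y ≤ V y := fun n y => min_le_left _ _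
  have hWn : ∀ n y, W n y ≤ n := fun n y => min_le_right _ _
  have hWs : ∀ n x, Summable fun y => P x y * W n y := fun n x =>
    (hG x).summable.of_nonneg_of_le (fun y => mul_nonneg (hP.1 x y) (hW0 n y)) fun y =>
      mul_le_mul_of_nonneg_left (hWV n y) (hP.1 x y)
  let H : ℕ → S → ℝ := fun n x => ∑' y, P x y * W n y
  have hH : ∀ n x, HasSum (fun y => P x y * W n y) (H n x) := fun n x => (hWs n x).hasSum
  have hHn : ∀ n x, H n x ≤ n := fun n x => by
    have := hasSum_le (fun y => mul_le_mul_of_nonneg_left (hWn n y) (hP.1 x y)) (hH n x)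
      ((hP.2 x).mul_right (n : ℝ))
    simpa using this
  have hHG : ∀ n x, H n x ≤ G x := fun n x =>
    hasSum_le (fun y => mul_le_mul_of_nonneg_left (hWV n y) (hP.1 x y)) (hH n x) (hG x)
  have hH0 : ∀ n x, 0 ≤ H n x := fun n x =>
    tsum_nonneg fun y => mul_nonneg (hP.1 x y) (hW0 n y)
  have hlow : ∀ n x, W n x - δ ≤ H n x := fun n x => by
    have h1 := (hP.2 x).mul_right (W n x - δ)
    rw [one_mul] at h1
    refine hasSum_le (fun y => ?_) h1 (hH n x)
    by_cases hxy : P x y = 0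
    · simp [hxy]
    · refine mul_le_mul_of_nonneg_left ?_ (hP.1 x y)
      have := hdown x y hxy
      refine le_min ?_ ?_
      · linarith [hWV n x]
      · linarith [hWn n x]
  have hhigh : ∀ n x, H n x ≤ W n x + κ := fun n x => by
    rcases le_total (V x) n with h | h
    · have : W n x = V x := min_eq_left h
      linarith [hHG n x, hup x]
    · have : W n x = n := min_eq_right h
      linarith [hHn n x]
  -- The bound is uniform in `n`: truncation keeps the limit `δ` on downward jumps, and where `V ≥
  -- n` the truncation has no upward drift. A constant is integrable for the finite measure `μ`, so
  -- dominated convergence applies.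
  have hbound : ∀ n x, |H n x - W n x| ≤ δ + κ := fun n x =>
    abs_le.2 ⟨by linarith [hlow n x], by linarith [hhigh n x]⟩
  have hWlim : ∀ x, Tendsto (fun n => W n x) atTop (𝓝 (V x)) := fun x => by
    refine tendsto_const_nhds.congr' ?_
    filter_upwards [eventually_ge_atTop ⌈V x⌉₊] with n hn
    exact (min_eq_left ((Nat.le_ceil _).trans (Nat.cast_le.2 hn))).symm
  have hHlim : ∀ x, Tendsto (fun n => H n x) atTop (𝓝 (G x)) := fun x => by
    rw [← (hG x).tsum_eq]
    refine tendsto_tsum_of_dominated_convergence (hG x).summable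
      (fun y => (hWlim y).const_mul _) (.of_forall fun n y => ?_)
    rw [Real.norm_of_nonneg (mul_nonneg (hP.1 x y) (hW0 n y))]
    exact mul_le_mul_of_nonneg_left (hWV n y) (hP.1 x y)
  have hlim : ∀ x, Tendsto (fun n => H n x - W n x) atTop (𝓝 (G x - V x)) := fun x =>
    (hHlim x).sub (hWlim x)
  have hGb : ∀ x, |G x - V x| ≤ δ + κ := fun x =>
    le_of_tendsto (hlim x).abs (.of_forall fun n => hbound n x)
  have hdom : Summable fun x => μ x * (δ + κ) := hμs.mul_right _
  refine ⟨.of_norm_bounded hdom fun x => ?_, ?_⟩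
  · rw [norm_mul, Real.norm_of_nonneg (hμ x), Real.norm_eq_abs]
    exact mul_le_mul_of_nonneg_left (hGb x) (hμ x)
  have hmain : Tendsto (fun n : ℕ => ∑' x, μ x * (H n x - W n x)) atTop
      (𝓝 (∑' x, μ x * (G x - V x))) := by
    refine tendsto_tsum_of_dominated_convergence hdom
      (fun x => (hlim x).const_mul _) (.of_forall fun n x => ?_)
    rw [norm_mul, Real.norm_of_nonneg (hμ x), Real.norm_eq_abs]
    exact mul_le_mul_of_nonneg_left (hbound n x) (hμ x)
  refine hmain.congr fun n => ?_
  have hs1 : Summable fun x => μ x * H n x :=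
    (hμs.mul_right (n : ℝ)).of_nonneg_of_le (fun x => mul_nonneg (hμ x) (hH0 n x)) fun x =>
      mul_le_mul_of_nonneg_left (hHn n x) (hμ x)
  have hs2 : Summable fun x => μ x * W n x :=
    (hμs.mul_right (n : ℝ)).of_nonneg_of_le (fun x => mul_nonneg (hμ x) (hW0 n x)) fun x =>
      mul_le_mul_of_nonneg_left (hWn n x) (hμ x)
  have h1 := hP.hasSum_vecStep_mul hμ hμs (hW0 n) (hH n) hs1.hasSum
  have h2 := (h1.sub hs2.hasSum).tsum_eq
  have h3 := (hs1.hasSum.sub hs2.hasSum).tsum_eq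
  simp only [mul_sub, sub_mul]
  rw [h3]
  exact h2.symm

/-- A function with drift at most `g - ε`, where `g` vanishes outside a finite set: lower bound
for the integral of `g`. -/
theorem IsStochastic.le_sum_of_drift (hP : IsStochastic P) (hμ : ∀ x, 0 ≤ μ x)
    (hμ1 : HasSum μ 1) {V G g : S → ℝ} {δ ε θ : ℝ} {C : Finset S} (hδ : 0 ≤ δ)
    (hV : ∀ x, 0 ≤ V x) (hG : ∀ x, HasSum (fun y => P x y * V y) (G x))
    (hdown : ∀ x y, P x y ≠ 0 → V x - δ ≤ V y) (hε : 0 ≤ ε)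
    (hdrift : ∀ x, G x - V x ≤ g x - ε) (hg : ∀ x, x ∉ C → g x = 0)
    (hθ : ∀ n : ℕ, -θ ≤ ∑' y, (vecStep P μ y - μ y) * min (V y) n) :
    ε - θ ≤ ∑ x ∈ C, μ x * g x := by
  have hκ : ∀ x, G x ≤ V x + ∑ y ∈ C, |g y| := fun x => by
    have h1 : g x ≤ ∑ y ∈ C, |g y| := by
      by_cases hx : x ∈ C
      · exact (le_abs_self _).trans
          (Finset.single_le_sum (f := fun y => |g y|) (fun y _ => abs_nonneg _) hx)
      · rw [hg x hx]
        exact Finset.sum_nonneg fun y _ => abs_nonneg _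
    linarith [hdrift x]
  obtain ⟨hs, hlim⟩ := hP.tendsto_truncated_drift hμ hμ1.summable hδ
    (Finset.sum_nonneg fun y _ => abs_nonneg _) hV hG hdown hκ
  have h1 : -θ ≤ ∑' x, μ x * (G x - V x) := ge_of_tendsto hlim (.of_forall hθ)
  have h2 : HasSum (fun x => μ x * g x) (∑ x ∈ C, μ x * g x) :=
    hasSum_sum_of_ne_finset_zero fun x hx => by rw [hg x hx, mul_zero]
  have h3 := hasSum_le (fun x => ?_) hs.hasSum (h2.sub (hμ1.mul_right ε))
  · linarith
  · have := mul_le_mul_of_nonneg_left (hdrift x) (hμ x)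
    linarith

/-- Equality in the drift bound for a stationary distribution. -/
theorem IsStationaryDist.sum_eq_of_drift (hP : IsStochastic P) (h : IsStationaryDist P μ)
    {V G g : S → ℝ} {δ ε : ℝ} {C : Finset S} (hδ : 0 ≤ δ)
    (hV : ∀ x, 0 ≤ V x) (hG : ∀ x, HasSum (fun y => P x y * V y) (G x))
    (hdown : ∀ x y, P x y ≠ 0 → V x - δ ≤ V y) (hε : 0 ≤ ε)
    (hdrift : ∀ x, G x - V x = g x - ε) (hg : ∀ x, x ∉ C → g x = 0) :
    ∑ x ∈ C, μ x * g x = ε := by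
  have hκ : ∀ x, G x ≤ V x + ∑ y ∈ C, |g y| := fun x => by
    have h1 : g x ≤ ∑ y ∈ C, |g y| := by
      by_cases hx : x ∈ C
      · exact (le_abs_self _).trans
          (Finset.single_le_sum (f := fun y => |g y|) (fun y _ => abs_nonneg _) hx)
      · rw [hg x hx]
        exact Finset.sum_nonneg fun y _ => abs_nonneg _
    linarith [hdrift x]
  obtain ⟨hs, hlim⟩ := hP.tendsto_truncated_drift h.1 h.2.1.summable hδ
    (Finset.sum_nonneg fun y _ => abs_nonneg _) hV hG hdown hκ
  -- By stationarity every truncated integral is zero, so the limit is zero.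
  simp only [h.vecStep_eq, sub_self, zero_mul, tsum_zero] at hlim
  have h0 := tendsto_nhds_unique hlim tendsto_const_nhds
  have h2 : HasSum (fun x => μ x * g x) (∑ x ∈ C, μ x * g x) :=
    hasSum_sum_of_ne_finset_zero fun x hx => by rw [hg x hx, mul_zero]
  have h3 := (h2.sub (h.2.1.mul_right ε)).tsum_eq
  simp only [hdrift, mul_sub] at h0
  rw [h3] at h0
  linarith

theorem IsStationaryDist.le_sum_of_drift (hP : IsStochastic P) (h : IsStationaryDist P μ)
    {V G g : S → ℝ} {δ ε : ℝ} {C : Finset S} (hδ : 0 ≤ δ)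
    (hV : ∀ x, 0 ≤ V x) (hG : ∀ x, HasSum (fun y => P x y * V y) (G x))
    (hdown : ∀ x y, P x y ≠ 0 → V x - δ ≤ V y) (hε : 0 ≤ ε)
    (hdrift : ∀ x, G x - V x ≤ g x - ε) (hg : ∀ x, x ∉ C → g x = 0) :
    ε ≤ ∑ x ∈ C, μ x * g x := by
  have := hP.le_sum_of_drift h.1 h.2.1 (θ := 0) hδ hV hG hdown hε hdrift hg fun n => by
    simp [h.vecStep_eq]
  simpa using this

end Markov

/-! ### Foster's criterion and convergence without loss of mass. -/

section Existence

variable {S : Type*} {P : Matrix S S ℝ}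

/-- A measure obtained as a pointwise limit could vanish; a lower bound over a finite set, preserved
by such limits, rules this out. The sign of `g` is irrelevant. -/
theorem tsum_pos_of_sum_mul_pos {μ g : S → ℝ} {C : Finset S} {ε : ℝ} (hμ : ∀ x, 0 ≤ μ x)
    (hs : Summable μ) (hε : 0 < ε) (h : ε ≤ ∑ x ∈ C, μ x * g x) :
    (∃ x ∈ C, 0 < μ x) ∧ 0 < ∑' x, μ x := by
  obtain ⟨x, hxC, hx⟩ := Finset.exists_ne_zero_of_sum_ne_zero (hε.trans_le h).ne'
  have hx : 0 < μ x := lt_of_le_of_ne (hμ x) (left_ne_zero_of_mul hx).symm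
  exact ⟨⟨x, hxC, hx⟩, hs.tsum_pos hμ x hx⟩

theorem IsStochastic.iterate_vecStep (hP : IsStochastic P) {μ : S → ℝ} (hμ : ∀ x, 0 ≤ μ x)
    (hs : HasSum μ 1) (t : ℕ) :
    (∀ x, 0 ≤ (vecStep P)^[t] μ x) ∧ HasSum ((vecStep P)^[t] μ) 1 := by
  induction t with
  | zero => exact ⟨hμ, hs⟩
  | succ t ih =>
    rw [Function.iterate_succ_apply']
    exact ⟨hP.vecStep_nonneg ih.1, hP.hasSum_vecStep_mass ih.1 ih.2⟩

/-- Foster's criterion: a stochastic matrix with a drift towards a finite set has a stationary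
distribution. -/
theorem IsStochastic.exists_stationaryDist [Nonempty S] (hP : IsStochastic P)
    {V G g : S → ℝ} {δ ε : ℝ} {C : Finset S} (hδ : 0 ≤ δ)
    (hV : ∀ x, 0 ≤ V x) (hG : ∀ x, HasSum (fun y => P x y * V y) (G x))
    (hdown : ∀ x y, P x y ≠ 0 → V x - δ ≤ V y) (hε : 0 < ε)
    (hdrift : ∀ x, G x - V x ≤ g x - ε) (hg : ∀ x, x ∉ C → g x = 0) :
    ∃ μ, IsStationaryDist P μ := by
  classical
  obtain ⟨x₀⟩ := ‹Nonempty S›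
  let p : ℕ → S → ℝ := fun t => (vecStep P)^[t] (Pi.single x₀ 1)
  have hp0 : ∀ x, 0 ≤ (Pi.single x₀ 1 : S → ℝ) x := fun x => by
    rw [Pi.single_apply]; split_ifs <;> norm_num
  have hp1 : HasSum (Pi.single x₀ 1 : S → ℝ) 1 := hasSum_pi_single x₀ 1
  have hp : ∀ t, (∀ x, 0 ≤ p t x) ∧ HasSum (p t) 1 := hP.iterate_vecStep hp0 hp1
  have hpS : ∀ t, vecStep P (p t) = p (t + 1) := fun t =>
    (Function.iterate_succ_apply' _ _ _).symm
  -- Cesàro averages of the laws started at `x₀`: the defect `ν P - ν` telescopes and is `O(1/n)`.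
  let ν : ℕ → S → ℝ := fun n x => (∑ t ∈ Finset.range (n + 1), p t x) / (n + 1 : ℝ)
  have hn : ∀ n : ℕ, (0 : ℝ) < n + 1 := fun n => by positivity
  have hν : ∀ n, (∀ x, 0 ≤ ν n x) ∧ HasSum (ν n) 1 := fun n => by
    refine ⟨fun x => div_nonneg (Finset.sum_nonneg fun t _ => (hp t).1 x) (hn n).le, ?_⟩
    have := (hasSum_sum (s := Finset.range (n + 1)) fun t _ => (hp t).2).div_const (n + 1 : ℝ)
    simpa [(hn n).ne'] using this
  have hνstep : ∀ n y, vecStep P (ν n) y - ν n y = (p (n + 1) y - p 0 y) / (n + 1 : ℝ) := by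
    intro n y
    have h1 : vecStep P (ν n) y = (∑ t ∈ Finset.range (n + 1), p (t + 1) y) / (n + 1 : ℝ) := by
      have := (hasSum_sum (s := Finset.range (n + 1)) fun t _ =>
        hP.hasSum_vecStep (hp t).1 (hp t).2.summable y).div_const (n + 1 : ℝ)
      simp only [hpS, ← Finset.sum_mul] at this
      rw [← this.tsum_eq]
      exact tsum_congr fun x => div_mul_eq_mul_div _ _ _
    rw [h1, ← sub_div, ← Finset.sum_sub_distrib, Finset.sum_range_sub fun t => p t y]
  have hle1 : ∀ t x, p t x ≤ 1 := fun t x => le_hasSum (hp t).2 x fun y _ => (hp t).1 y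
  have hinv0 : ∀ c : ℝ, Tendsto (fun n : ℕ => c / (n + 1 : ℝ)) atTop (𝓝 0) := fun c =>
    tendsto_const_nhds.div_atTop (tendsto_natCast_atTop_atTop.atTop_add tendsto_const_nhds)
  have hinv : ∀ y, Tendsto (fun n => vecStep P (ν n) y - ν n y) atTop (𝓝 0) := fun y => by
    refine squeeze_zero_norm (fun n => ?_) (hinv0 1)
    rw [hνstep, norm_div, Real.norm_of_nonneg (hn n).le, Real.norm_eq_abs]
    refine div_le_div_of_nonneg_right (abs_le.2 ⟨?_, ?_⟩) (hn n).le
    · linarith [(hp (n + 1)).1 y, hle1 0 y]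
    · linarith [(hp 0).1 y, hle1 (n + 1) y]
  -- In the telescoped defect only the initial law contributes negatively, by at most `V x₀ / (n +
  -- 1)`.
  have hC : ∀ n : ℕ, ε - V x₀ / (n + 1 : ℝ) ≤ ∑ x ∈ C, ν n x * g x := fun n => by
    refine hP.le_sum_of_drift (hν n).1 (hν n).2 hδ hV hG hdown hε.le hdrift hg fun L => ?_
    have hW0 : ∀ y, 0 ≤ min (V y) L := fun y => le_min (hV y) L.cast_nonneg
    have h1 : Summable fun y => p (n + 1) y * min (V y) L :=
      ((hp (n + 1)).2.summable.mul_right (L : ℝ)).of_nonneg_of_le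
        (fun y => mul_nonneg ((hp _).1 y) (hW0 y)) fun y =>
          mul_le_mul_of_nonneg_left (min_le_right _ _) ((hp _).1 y)
    have h2 : HasSum (fun y => p 0 y * min (V y) L) (min (V x₀) L) := by
      have := hasSum_single (f := fun y => p 0 y * min (V y) (L : ℝ)) x₀ fun y hy => by
        simp [p, hy]
      simpa [p] using this
    have h3 := ((h1.hasSum.sub h2).div_const (n + 1 : ℝ)).tsum_eq
    have h4 : 0 ≤ ∑' y, p (n + 1) y * min (V y) L :=
      tsum_nonneg fun y => mul_nonneg ((hp _).1 y) (hW0 y)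
    simp only [hνstep, div_mul_eq_mul_div, sub_mul]
    rw [h3, ← neg_div]
    exact div_le_div_of_nonneg_right (by linarith [min_le_left (V x₀) (L : ℝ)]) (hn n).le
  let U : Ultrafilter ℕ := Ultrafilter.of atTop
  have hU : (U : Filter ℕ) ≤ atTop := Ultrafilter.of_le atTop
  obtain ⟨μ, hμ⟩ := exists_tendsto_ultrafilter U (.of_forall hν)
  obtain ⟨h0, hs, -, hμinv⟩ := hP.invariant_of_tendsto (l := U) (Q := fun _ => P)
    (.of_forall fun _ => hP) (.of_forall hν) (fun _ _ => tendsto_const_nhds) hμ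
    fun y => (hinv y).mono_left hU
  have hlim : ε ≤ ∑ x ∈ C, μ x * g x := by
    have h1 := (tendsto_const_nhds (x := ε)).sub ((hinv0 (V x₀)).mono_left hU)
    rw [sub_zero] at h1
    exact le_of_tendsto_of_tendsto h1 (tendsto_finsetSum C fun x _ => (hμ x).mul_const (g x))
      (.of_forall hC)
  exact ⟨_, hP.isStationaryDist_div h0 hs.hasSum (tsum_pos_of_sum_mul_pos h0 hs hε hlim).2 hμinv⟩

/-- Convergence in total variation of stationary distributions, given a drift function whose drift
under the limit `P` is exactly `-ε` off a finite set, and at most that under the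
approximations. -/
theorem tendsto_tvNorm_stationaryDist (hP : IsStochastic P) {π : S → ℝ}
    (hπ : IsStationaryDist P π) (huniq : ∀ μ, IsStationaryDist P μ → μ = π)
    {Q : ℕ → Matrix S S ℝ} {ν : ℕ → S → ℝ} (hQ : ∀ᶠ n in atTop, IsStochastic (Q n))
    (hν : ∀ᶠ n in atTop, IsStationaryDist (Q n) (ν n))
    (hQP : ∀ x y, Tendsto (fun n => Q n x y) atTop (𝓝 (P x y)))
    {g : S → ℝ} {ε : ℝ} {C : Finset S} (hε : 0 < ε) (hπε : ∑ x ∈ C, π x * g x = ε)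
    (hνε : ∀ᶠ n in atTop, ε ≤ ∑ x ∈ C, ν n x * g x) :
    Tendsto (fun n => tvNorm (ν n - π)) atTop (𝓝 0) := by
  have hν' : ∀ᶠ n in atTop, (∀ x, 0 ≤ ν n x) ∧ HasSum (ν n) 1 :=
    hν.mono fun n hn => ⟨hn.1, hn.2.1⟩
  refine tendsto_tvNorm_sub hπ.1 hπ.2.1 hν' fun x => ?_
  rw [tendsto_iff_ultrafilter]
  intro U hU
  obtain ⟨μ, hμ⟩ := exists_tendsto_ultrafilter U (hν'.filter_mono hU)
  obtain ⟨h0, hs, hle, hinv⟩ := hP.invariant_of_tendsto (l := U) (hQ.filter_mono hU)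
    (hν'.filter_mono hU) (fun x y => (hQP x y).mono_left hU) hμ fun y => by
      refine tendsto_const_nhds.congr' ((hν.filter_mono hU).mono fun n hn => ?_)
      dsimp only
      rw [hn.vecStep_eq, sub_self]
  have hlim : ε ≤ ∑ x ∈ C, μ x * g x :=
    ge_of_tendsto (tendsto_finsetSum C fun x _ => (hμ x).mul_const (g x)) (hνε.filter_mono hU)
  have hm := (tsum_pos_of_sum_mul_pos h0 hs hε hlim).2
  have hμπ : ∀ x, μ x = (∑' x, μ x) * π x := fun x => by
    rw [← huniq _ (hP.isStationaryDist_div h0 hs.hasSum hm hinv)]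
    field_simp
  have h1 : ∑ x ∈ C, μ x * g x = (∑' x, μ x) * ε := by
    rw [← hπε, Finset.mul_sum]
    exact Finset.sum_congr rfl fun x _ => by rw [hμπ x]; ring
  -- With `c` the mass of `μ`, the limit inequality is `ε ≤ c ε`, while `c ≤ 1`.
  have h2 : ∑' x, μ x = 1 := by
    rw [h1] at hlim
    exact le_antisymm hle (le_of_mul_le_mul_right (by linarith) hε)
  have := hμ x
  rwa [hμπ x, h2, one_mul] at this

end Existence

/-! ### The Poisson equation of the phase process. -/

section Poisson

theorem Matrix.IsIrreducible.reflTransGen {S : Type*} {P : Matrix S S ℝ} (h : P.IsIrreducible)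
    (x y : S) : Relation.ReflTransGen (fun x y => 0 < P x y) x y := by
  let := P.toQuiver
  obtain ⟨p, -⟩ := h.connected x y
  induction p with
  | nil => exact .refl
  | cons _ e ih => exact ih.tail e.down

/-- Harmonic functions of a finite irreducible stochastic matrix are constant. -/
theorem IsStochastic.harmonic_eq_const {n : Type*} [Fintype n] [Nonempty n] {A : Matrix n n ℝ}
    (hA : IsStochastic A) (hirr : A.IsIrreducible) {h : n → ℝ}
    (hh : ∀ i, ∑ j, A i j * h j = h i) : ∃ c, ∀ i, h i = c := by
  obtain ⟨i₀, hi₀⟩ := Finite.exists_max h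
  have hrow : ∀ i, ∑ j, A i j = 1 := fun i => (hasSum_fintype _).unique (hA.2 i)
  refine ⟨h i₀, fun j => ?_⟩
  induction hirr.reflTransGen i₀ j with
  | refl => rfl
  | @tail b c _ hbc ih =>
    -- Maximum principle: at a maximizer the average of the nonnegative deficits is zero, so each
    -- successor is also a maximizer.
    have h1 : ∑ j, A b j * (h i₀ - h j) = 0 := by
      simp only [mul_sub, Finset.sum_sub_distrib, ← Finset.sum_mul, hrow, hh, ih]
      ring
    rw [Finset.sum_eq_zero_iff_of_nonneg fun j _ =>
      mul_nonneg (hA.1 b j) (sub_nonneg.2 (hi₀ j))] at h1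
    have := (mul_eq_zero.1 (h1 c (Finset.mem_univ c))).resolve_left hbc.ne'
    linarith

/-- The Poisson equation of a finite irreducible stochastic matrix has a nonnegative solution. -/
theorem IsStochastic.exists_poisson {n : Type*} [Fintype n] [Nonempty n] {A : Matrix n n ℝ}
    (hA : IsStochastic A) (hirr : A.IsIrreducible) {ϖ : n → ℝ} (hϖ : IsStationaryDist A ϖ)
    (m : n → ℝ) :
    ∃ a : n → ℝ, (∀ i, 0 ≤ a i) ∧ ∀ i, m i + ∑ j, A i j * a j - a i = ∑ i, ϖ i * m i := by
  classical
  have hrow : ∀ i, ∑ j, A i j = 1 := fun i => (hasSum_fintype _).unique (hA.2 i)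
  have hcol : ∀ j, ∑ i, ϖ i * A i j = ϖ j := fun j => (hasSum_fintype _).unique (hϖ.2.2 j)
  have hone : ∑ i, ϖ i = 1 := (hasSum_fintype _).unique hϖ.2.1
  let T : (n → ℝ) →ₗ[ℝ] (n → ℝ) := LinearMap.id - A.mulVecLin
  let φ : (n → ℝ) →ₗ[ℝ] ℝ := Fintype.linearCombination ℝ ϖ
  have hT : ∀ a i, T a i = a i - ∑ j, A i j * a j := fun a i => rfl
  have hφ : ∀ v, φ v = ∑ i, ϖ i * v i := fun v => by
    simp [φ, Fintype.linearCombination_apply, mul_comm]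
  have hle : T.range ≤ φ.ker := by
    rintro _ ⟨a, rfl⟩
    rw [LinearMap.mem_ker, hφ]
    simp only [hT, mul_sub, Finset.sum_sub_distrib, Finset.mul_sum]
    rw [Finset.sum_comm, sub_eq_zero]
    refine Finset.sum_congr rfl fun j _ => ?_
    simp only [← mul_assoc, ← Finset.sum_mul, hcol]
  have hker : Module.finrank ℝ T.ker ≤ 1 := by
    refine finrank_le_one (⟨fun _ => 1, ?_⟩ : T.ker) fun w => ?_
    · rw [LinearMap.mem_ker]
      ext i
      simp [hT, hrow]
    · obtain ⟨c, hc⟩ := hA.harmonic_eq_const hirr (h := w) fun i => by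
        have := congrFun (LinearMap.mem_ker.1 w.2) i
        rw [hT, Pi.zero_apply] at this
        linarith
      exact ⟨c, Subtype.ext (funext fun i => by simp [hc i])⟩
  have hφr : Module.finrank ℝ φ.range = 1 := by
    have : φ.range = ⊤ := LinearMap.range_eq_top.2 fun c => ⟨fun _ => c, by
      rw [hφ, ← Finset.sum_mul, hone, one_mul]⟩
    rw [this, finrank_top, Module.finrank_self]
  have hT' := T.finrank_range_add_finrank_ker
  have hφ' := φ.finrank_range_add_finrank_ker
  -- Fredholm alternative by dimension: `ker (I - A)` is at most the constants, so the range has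
  -- dimension at least that of the hyperplane `ker ϖ` containing it.
  have heq : T.range = φ.ker := Submodule.eq_of_le_of_finrank_le hle (by omega)
  have hmem : (fun i => m i - ∑ i, ϖ i * m i) ∈ T.range := by
    rw [heq, LinearMap.mem_ker, hφ]
    simp only [mul_sub, Finset.sum_sub_distrib, ← Finset.sum_mul, hone]
    ring
  obtain ⟨b, hb⟩ := hmem
  -- Solutions may be shifted by constants because `A e = e`; subtracting the minimum makes this one
  -- nonnegative.
  obtain ⟨i₀, hi₀⟩ := Finite.exists_min b
  refine ⟨fun i => b i - b i₀, fun i => sub_nonneg.2 (hi₀ i), fun i => ?_⟩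
  have := congrFun hb i
  rw [hT] at this
  simp only [mul_sub, Finset.sum_sub_distrib, ← Finset.sum_mul, hrow]
  linarith

end Poisson

/-! ### Moving the tail of a sequence to one index. -/

section Clip

/-- The sequence obtained from `r` by moving all the mass beyond `L` to `L`. -/
noncomputable def clipSeq (L : ℕ) (r : ℕ → ℝ) (l : ℕ) : ℝ :=
  if l < L then r l else if l = L then ∑' m : ℕ, r (L + m) else 0

theorem clipSeq_nonneg {L : ℕ} {r : ℕ → ℝ} (hr : ∀ l, 0 ≤ r l) (l : ℕ) : 0 ≤ clipSeq L r l := by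
  unfold clipSeq
  split_ifs
  exacts [hr l, tsum_nonneg fun m => hr _, le_rfl]

theorem clipSeq_of_lt {L l : ℕ} (h : l < L) (r : ℕ → ℝ) : clipSeq L r l = r l := if_pos h

theorem clipSeq_self (L : ℕ) (r : ℕ → ℝ) : clipSeq L r L = ∑' m : ℕ, r (L + m) := by
  simp [clipSeq]

theorem clipSeq_of_gt {L l : ℕ} (h : L < l) (r : ℕ → ℝ) : clipSeq L r l = 0 := by
  simp [clipSeq, h.not_gt, h.ne']

/-- Clipping is the image of `r` under `l ↦ min l L`, so it can be transferred to the test function,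
where monotonicity becomes usable. -/
theorem hasSum_clipSeq_mul {r : ℕ → ℝ} (hr : Summable r) (L : ℕ) (f : ℕ → ℝ) :
    ∃ s, HasSum (fun l => clipSeq L r l * f l) s ∧ HasSum (fun l => r l * f (min l L)) s := by
  refine ⟨(∑' m : ℕ, r (L + m)) * f L + ∑ l ∈ Finset.range L, r l * f l, ?_, ?_⟩
  · have h : HasSum (fun l => clipSeq L r l * f l)
        (∑ l ∈ Finset.range (L + 1), clipSeq L r l * f l) :=
      hasSum_sum_of_ne_finset_zero fun l hl => by
        have : L < l := by simpa using hl
        rw [clipSeq_of_gt this, zero_mul]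
    rw [Finset.sum_range_succ, add_comm] at h
    rw [clipSeq_self] at h
    convert h using 2
    refine Finset.sum_congr rfl fun l hl => ?_
    rw [clipSeq_of_lt (Finset.mem_range.1 hl)]
  · have h1 : HasSum (fun m => r (m + L) * f (min (m + L) L)) ((∑' m : ℕ, r (L + m)) * f L) := by
      simp only [add_comm L, Nat.le_add_left, min_eq_right]
      exact ((summable_nat_add_iff L).2 hr).hasSum.mul_right (f L)
    have h2 := (hasSum_nat_add_iff (f := fun l => r l * f (min l L)) L).1 h1
    rwa [Finset.sum_congr rfl fun l hl => by
      rw [min_eq_left (Finset.mem_range.1 hl).le]] at h2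

end Clip

/-! ### The truncated chain as a rowwise clipping of the original. -/

namespace MG1Blocks

variable {M₀ M₁ : ℕ} {D : MG1Blocks M₀ M₁}

theorem hasSum_state {f : MG1State M₀ M₁ → ℝ} {s : Fin M₁ → ℝ}
    (h : ∀ j, HasSum (fun l : ℕ => f (.inr (l, j))) (s j)) :
    HasSum f (∑ i, f (.inl i) + ∑ j, s j) := by
  refine HasSum.sum (hasSum_fintype _) ?_
  have h1 : ∀ j, HasSum (fun p : ℕ × Fin M₁ => if p.2 = j then f (.inr (p.1, j)) else 0) (s j) := by
    intro j
    have hinj : Function.Injective fun l : ℕ => (l, j) := fun a b hab => congrArg Prod.fst hab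
    refine (hinj.hasSum_iff fun p hp => ?_).1 (by simpa [Function.comp_def] using h j)
    rw [if_neg]
    rintro rfl
    exact hp ⟨p.1, rfl⟩
  have h2 := hasSum_sum (s := Finset.univ) fun j _ => h1 j
  simpa [Function.comp_def] using h2

theorem P_inl_inr (i : Fin M₀) (l : ℕ) (j : Fin M₁) :
    D.P (.inl i) (.inr (l, j)) = D.Bup (l + 1) i j := rfl

theorem P_inr_inr (k : ℕ) (i : Fin M₁) (l : ℕ) (j : Fin M₁) :
    D.P (.inr (k, i)) (.inr (l, j)) =
      if -1 ≤ (l : ℤ) - k then D.A ((l : ℤ) - k) i j else 0 := rfl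

theorem P_inr_inr_of_lt {k l : ℕ} (h : l + 1 < k) (i j : Fin M₁) :
    D.P (.inr (k, i)) (.inr (l, j)) = 0 := by
  rw [P_inr_inr, if_neg (by omega)]

theorem P_inr_inr_of_eq {k l n : ℕ} (h : l + 1 = n + k) (i j : Fin M₁) :
    D.P (.inr (k, i)) (.inr (l, j)) = D.A ((n : ℤ) - 1) i j := by
  rw [P_inr_inr, if_pos (by omega), show (l : ℤ) - k = (n : ℤ) - 1 by omega]

theorem trunc_A_apply (N : ℕ) (m : ℤ) (i j : Fin M₁) :
    (D.trunc N).A m i j = if m < (N : ℤ) then D.A m i j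
      else if m = (N : ℤ) then ∑' r : ℕ, D.A ((N : ℤ) + r) i j else 0 := by
  simp only [trunc]
  split_ifs <;> rfl

theorem trunc_Bup_apply (N k : ℕ) (i : Fin M₀) (j : Fin M₁) :
    (D.trunc N).Bup k i j = if k < N then D.Bup k i j
      else if k = N then ∑' r : ℕ, D.Bup (N + r) i j else 0 := by
  simp only [trunc]
  split_ifs <;> rfl

/-- The index of the last level that is reachable from `x` in the truncation at `N`. -/
def lastLevel (N : ℕ) : MG1State M₀ M₁ → ℕ
  | Sum.inl _ => N - 1
  | Sum.inr (k, _) => k + N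

theorem trunc_P_inl (N : ℕ) (x : MG1State M₀ M₁) (j : Fin M₀) :
    (D.trunc N).P x (.inl j) = D.P x (.inl j) := by
  rcases x with i | ⟨k, i⟩ <;> rfl

theorem trunc_P_inr {N : ℕ} (hN : 1 ≤ N) (x : MG1State M₀ M₁) (l : ℕ) (j : Fin M₁) :
    (D.trunc N).P x (.inr (l, j)) =
      clipSeq (lastLevel N x) (fun l => D.P x (.inr (l, j))) l := by
  rcases x with i | ⟨k, i⟩
  · obtain ⟨N, rfl⟩ : ∃ n, N = n + 1 := ⟨N - 1, by omega⟩
    simp only [P_inl_inr, trunc_Bup_apply, clipSeq, lastLevel, add_lt_add_iff_right,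
      add_left_inj, Nat.add_sub_cancel, add_right_comm]
  · rw [P_inr_inr, trunc_A_apply, lastLevel]
    rcases lt_trichotomy l (k + N) with h | rfl | h
    · rw [clipSeq_of_lt h, P_inr_inr, if_pos (by omega : (l : ℤ) - k < N)]
    · rw [clipSeq_self, if_pos (by omega), if_neg (by omega), if_pos (by omega)]
      refine tsum_congr fun m => ?_
      rw [P_inr_inr, if_pos (by omega), show ((k + N + m : ℕ) : ℤ) - k = N + m by push_cast; ring]
    · rw [clipSeq_of_gt h, if_pos (by omega), if_neg (by omega), if_neg (by omega)]

theorem eventually_trunc_P_eq (x y : MG1State M₀ M₁) :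
    ∀ᶠ N : ℕ in atTop, (D.trunc N).P x y = D.P x y := by
  rcases y with j | ⟨l, j⟩
  · exact .of_forall fun N => trunc_P_inl N x j
  · filter_upwards [eventually_ge_atTop (l + 2)] with N hN
    rw [trunc_P_inr (by omega), clipSeq_of_lt]
    rcases x with i | ⟨k, i⟩ <;> simp only [lastLevel] <;> omega

/-- Truncation decreases the conditional expectation of a function that increases with the
level. -/
theorem exists_hasSum_trunc_le (hD : IsStochastic D.P) {N : ℕ} (hN : 1 ≤ N)
    (x : MG1State M₀ M₁) {f : MG1State M₀ M₁ → ℝ} (hf : ∀ j, Monotone fun l => f (.inr (l, j)))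
    {s : ℝ} (hs : HasSum (fun y => D.P x y * f y) s) :
    ∃ s' ≤ s, HasSum (fun y => (D.trunc N).P x y * f y) s' := by
  have hinj : ∀ j, Function.Injective fun l : ℕ => (Sum.inr (l, j) : MG1State M₀ M₁) :=
    fun j a b hab => congrArg Prod.fst (Sum.inr_injective hab)
  have h1 : ∀ j, Summable fun l : ℕ => D.P x (.inr (l, j)) := fun j =>
    (hD.2 x).summable.comp_injective (hinj j)
  have h2 : ∀ j, Summable fun l : ℕ => D.P x (.inr (l, j)) * f (.inr (l, j)) := fun j =>
    hs.summable.comp_injective (hinj j)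
  choose t ht ht' using fun j =>
    hasSum_clipSeq_mul (h1 j) (lastLevel N x) fun l => f (.inr (l, j))
  have h3 : HasSum (fun y => (D.trunc N).P x y * f y)
      (∑ i, (D.trunc N).P x (.inl i) * f (.inl i) + ∑ j, t j) :=
    hasSum_state fun j => by simpa only [trunc_P_inr hN] using ht j
  refine ⟨_, ?_, h3⟩
  have h4 := hs.unique (hasSum_state fun j => (h2 j).hasSum)
  simp only [trunc_P_inl]
  rw [h4]
  refine add_le_add le_rfl (Finset.sum_le_sum fun j _ => ?_)
  exact hasSum_le (fun l => mul_le_mul_of_nonneg_left (hf j (min_le_left _ _)) (hD.1 _ _))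
    (ht' j) (h2 j).hasSum

/-- The constants `1` and `-1` are both monotone in the level, so the comparison for monotone
functions bounds the row sums from both sides. -/
theorem isStochastic_trunc (hD : IsStochastic D.P) {N : ℕ} (hN : 1 ≤ N) :
    IsStochastic (D.trunc N).P := by
  refine ⟨fun x y => ?_, fun x => ?_⟩
  · rcases y with j | ⟨l, j⟩
    · rw [trunc_P_inl]
      exact hD.1 _ _
    · rw [trunc_P_inr hN]
      exact clipSeq_nonneg (fun l => hD.1 _ _) l
  · obtain ⟨s, hs, h⟩ := exists_hasSum_trunc_le hD hN x (f := fun _ => 1) (s := 1)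
      (fun _ => monotone_const) (by simpa using hD.2 x)
    obtain ⟨s', hs', h'⟩ := exists_hasSum_trunc_le hD hN x (f := fun _ => -1) (s := -1)
      (fun _ => monotone_const) (by simpa using (hD.2 x).neg)
    have : -s' = s := h'.neg.unique (by simpa using h)
    obtain rfl : s = 1 := by linarith
    simpa using h

/-! ### The drift function and its conditional expectations. -/

/-- The drift function: the level, corrected by a function `a` of the phase. -/
def driftFun (a : Fin M₁ → ℝ) : MG1State M₀ M₁ → ℝ
  | Sum.inl _ => 0
  | Sum.inr (k, i) => k + a i

theorem driftFun_inl (a : Fin M₁ → ℝ) (i : Fin M₀) :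
    driftFun a (.inl i : MG1State M₀ M₁) = 0 := rfl

theorem driftFun_inr (a : Fin M₁ → ℝ) (k : ℕ) (i : Fin M₁) :
    driftFun a (.inr (k, i) : MG1State M₀ M₁) = k + a i := rfl

theorem driftFun_nonneg {a : Fin M₁ → ℝ} (ha : ∀ i, 0 ≤ a i) (x : MG1State M₀ M₁) :
    0 ≤ driftFun a x := by
  rcases x with i | ⟨k, i⟩
  · exact le_rfl
  · exact add_nonneg k.cast_nonneg (ha i)

theorem driftFun_mono (a : Fin M₁ → ℝ) (j : Fin M₁) :
    Monotone fun l => driftFun (M₀ := M₀) a (.inr (l, j)) := fun l l' h => by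
  simpa [driftFun] using h

theorem driftFun_sub_le {a : Fin M₁ → ℝ} (ha : ∀ i, 0 ≤ a i) {x y : MG1State M₀ M₁}
    (h : D.P x y ≠ 0) : driftFun a x - (1 + ∑ i, a i) ≤ driftFun a y := by
  have hle : ∀ i, a i ≤ ∑ i, a i := fun i =>
    Finset.single_le_sum (fun j _ => ha j) (Finset.mem_univ i)
  have h0 : 0 ≤ ∑ i, a i := Finset.sum_nonneg fun j _ => ha j
  rcases x with i | ⟨k, i⟩
  · have := driftFun_nonneg ha y
    rw [driftFun_inl]
    linarith
  · rcases y with j | ⟨l, j⟩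
    · have hk : k = 0 := by
        by_contra hk
        exact h (if_neg hk)
      rw [driftFun_inl, driftFun_inr, hk, Nat.cast_zero]
      linarith [hle i]
    · have hk : k ≤ l + 1 := by
        by_contra hk
        exact h (if_neg (by omega))
      have hk' : (k : ℝ) ≤ l + 1 := by exact_mod_cast hk
      rw [driftFun_inr, driftFun_inr]
      linarith [hle i, ha j]

theorem A_nonneg (hD : IsStochastic D.P) (i j : Fin M₁) (n : ℕ) : 0 ≤ D.A ((n : ℤ) - 1) i j := by
  rw [← P_inr_inr_of_eq (k := 1) rfl]
  exact hD.1 _ _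

theorem hasSum_A (hD : IsStochastic D.P) (i j : Fin M₁) :
    HasSum (fun n : ℕ => D.A ((n : ℤ) - 1) i j) (D.Asum i j) := by
  have hinj : Function.Injective fun l : ℕ => (Sum.inr (l, j) : MG1State M₀ M₁) :=
    fun a b hab => congrArg Prod.fst (Sum.inr_injective hab)
  have := (hD.2 (.inr (1, i))).summable.comp_injective hinj
  exact (this.congr fun n => P_inr_inr_of_eq (D := D) (k := 1) (l := n) rfl i j).hasSum

theorem summable_drift (hD : D.BasicAssumption) (i j : Fin M₁) :
    Summable fun n : ℕ => ((n : ℝ) - 1) * D.A ((n : ℤ) - 1) i j := by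
  refine .of_norm_bounded (hD.mA_finite i).abs fun n => ?_
  have h0 := A_nonneg hD.stochastic i
  rw [driftTerm, norm_mul, abs_mul, Real.norm_eq_abs, Real.norm_of_nonneg (h0 j n),
    abs_of_nonneg (Finset.sum_nonneg fun j _ => h0 j n)]
  exact mul_le_mul_of_nonneg_left (Finset.single_le_sum (f := fun j => D.A ((n : ℤ) - 1) i j)
    (fun j _ => h0 j n) (Finset.mem_univ j)) (abs_nonneg _)

theorem mA_eq (hD : D.BasicAssumption) (i : Fin M₁) :
    D.mA i = ∑ j, ∑' n : ℕ, ((n : ℝ) - 1) * D.A ((n : ℤ) - 1) i j := by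
  rw [← Summable.tsum_finsetSum fun j _ => summable_drift hD i j]
  simp only [mA, driftTerm, Finset.mul_sum]

/-- The conditional expectation of the drift function in a level away from the boundary. -/
theorem hasSum_P_driftFun (hD : D.BasicAssumption) (a : Fin M₁ → ℝ) (k : ℕ) (i : Fin M₁) :
    HasSum (fun y => D.P (.inr (k + 1, i)) y * driftFun a y)
      (D.mA i + ((k : ℝ) + 1) + ∑ j, D.Asum i j * a j) := by
  have h1 : ∀ j, HasSum (fun l : ℕ => D.P (.inr (k + 1, i)) (.inr (l, j)) *
      driftFun a (.inr (l, j) : MG1State M₀ M₁))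
      ((∑' n : ℕ, ((n : ℝ) - 1) * D.A ((n : ℤ) - 1) i j) + D.Asum i j * (k + 1 + a j)) := by
    intro j
    have hadd := (summable_drift hD i j).hasSum.add
      ((hasSum_A hD.stochastic i j).mul_right ((k : ℝ) + 1 + a j))
    -- Reindex by `l = n + k`, so that the increment from index `k + 1` is `n - 1 ≥ -1`; smaller `l`
    -- are unreachable.
    refine ((add_left_injective k).hasSum_iff fun l hl => ?_).1 (hadd.congr_fun fun n => ?_)
    · have : l + 1 < k + 1 := by
        by_contra h
        exact hl ⟨l - k, by dsimp only; omega⟩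
      rw [P_inr_inr_of_lt this, zero_mul]
    · rw [Function.comp_apply, P_inr_inr_of_eq (n := n) (add_assoc n k 1), driftFun_inr]
      push_cast
      ring
  have h2 := hasSum_state (f := fun y => D.P (.inr (k + 1, i)) y * driftFun a y) h1
  convert h2 using 1
  have hrow : ∑ j, D.Asum i j = 1 := (hasSum_fintype _).unique (hD.stochastic_A.2 i)
  rw [Finset.sum_add_distrib, ← mA_eq hD]
  simp only [mul_add, Finset.sum_add_distrib, ← Finset.sum_mul, hrow, driftFun_inl, mul_zero,
    Finset.sum_const_zero]
  ring

theorem summable_P_driftFun (hD : D.BasicAssumption) (a : Fin M₁ → ℝ) (x : MG1State M₀ M₁) :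
    Summable fun y => D.P x y * driftFun a y := by
  rcases x with i | ⟨_ | k, i⟩
  · refine (hasSum_state (f := fun y => D.P (.inl i) y * driftFun a y)
      (s := fun j => ∑' l : ℕ, D.Bup (l + 1) i j * (l + a j))
      fun j => Summable.hasSum ?_).summable
    have h0 : ∀ (l : ℕ) j, 0 ≤ D.Bup (l + 1) i j := fun l j =>
      hD.stochastic.1 (.inl i) (.inr (l, j))
    have hinj : Function.Injective fun l : ℕ => (Sum.inr (l, j) : MG1State M₀ M₁) :=
      fun a b hab => congrArg Prod.fst (Sum.inr_injective hab)
    have h1 : Summable fun l : ℕ => D.Bup (l + 1) i j :=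
      (hD.stochastic.2 (.inl i)).summable.comp_injective hinj
    have h2 : Summable fun l : ℕ => D.Bup (l + 1) i j * l := by
      refine ((summable_nat_add_iff 1).2 (hD.mB_finite i)).of_nonneg_of_le
        (fun l => mul_nonneg (h0 l j) l.cast_nonneg) fun l => ?_
      rw [mul_comm]
      refine mul_le_mul (by push_cast; linarith) ?_ (h0 l j) (by positivity)
      exact Finset.single_le_sum (f := fun j => D.Bup (l + 1) i j) (fun j _ => h0 l j)
        (Finset.mem_univ j)
    simpa only [mul_add, P_inl_inr, driftFun_inr] using h2.add (h1.mul_right (a j))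
  · refine (hasSum_state (f := fun y => D.P (.inr (0, i)) y * driftFun a y)
      (s := fun j => ∑' l : ℕ, D.P (.inr (0, i)) (.inr (l, j)) * (l + a j))
      fun j => Summable.hasSum ?_).summable
    have h1 := (summable_nat_add_iff 1).2 (summable_drift hD i j)
    have h2 := (summable_nat_add_iff 1).2
      ((hasSum_A hD.stochastic i j).summable.mul_right (a j))
    refine (h1.add h2).congr fun l => ?_
    rw [P_inr_inr_of_eq (k := 0) (l := l) (n := l + 1) rfl, driftFun_inr]
    push_cast
    ring
  · exact (hasSum_P_driftFun hD a k i).summable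

end MG1Blocks

/-! ### Assembly of the theorem. -/

theorem theorem4p1 {M₀ M₁ : ℕ} (hM₀ : 0 < M₀) (hM₁ : 0 < M₁)
    (D : MG1Blocks M₀ M₁) (hD : D.BasicAssumption) :
    ∃ π : MG1State M₀ M₁ → ℝ,
      (IsStationaryDist D.P π ∧ ∀ π', IsStationaryDist D.P π' → π' = π) ∧
      (∀ N : ℕ, 1 ≤ N → ∃ πN, IsStationaryDist (D.trunc N).P πN) ∧
      (∀ᶠ N : ℕ in atTop, ∃! πN, IsStationaryDist (D.trunc N).P πN) ∧
      ∀ πN : ℕ → MG1State M₀ M₁ → ℝ,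
        (∀ N : ℕ, 1 ≤ N → IsStationaryDist (D.trunc N).P (πN N)) →
          Tendsto (fun N => tvNorm (πN N - π)) atTop (𝓝 0) := by
  have : Nonempty (Fin M₁) := ⟨⟨0, hM₁⟩⟩
  let z : MG1State M₀ M₁ := .inl ⟨0, hM₀⟩
  have : Nonempty (MG1State M₀ M₁) := ⟨z⟩
  obtain ⟨ϖ, hϖ, hneg⟩ := hD.drift_neg
  obtain ⟨a, ha, hpoisson⟩ := hD.stochastic_A.exists_poisson hD.irreducible_A hϖ D.mA
  set ε : ℝ := -∑ i, ϖ i * D.mA i with hεdef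
  have hε : 0 < ε := neg_pos.2 hneg
  let V : MG1State M₀ M₁ → ℝ := MG1Blocks.driftFun a
  let G : MG1State M₀ M₁ → ℝ := fun x => ∑' y, D.P x y * V y
  let g : MG1State M₀ M₁ → ℝ := fun x => G x - V x + ε
  -- Levels 0 and 1. Level 1 belongs to `C` because its downward jumps enter level 0, where `V` does
  -- not follow the formula `k + a i`.
  let C : Finset (MG1State M₀ M₁) := Finset.disjSum Finset.univ ({0} ×ˢ Finset.univ)
  have hV : ∀ x, 0 ≤ V x := MG1Blocks.driftFun_nonneg ha
  have hG : ∀ x, HasSum (fun y => D.P x y * V y) (G x) := fun x =>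
    (MG1Blocks.summable_P_driftFun hD a x).hasSum
  have hδ : 0 ≤ 1 + ∑ i, a i := add_nonneg zero_le_one (Finset.sum_nonneg fun i _ => ha i)
  have hg : ∀ x, x ∉ C → g x = 0 := by
    rintro (i | ⟨_ | k, i⟩) hx
    · simp [C] at hx
    · simp [C] at hx
    · have h1 := (hG (.inr (k + 1, i))).unique (MG1Blocks.hasSum_P_driftFun hD a k i)
      have h2 := hpoisson i
      simp only [g, h1, V, MG1Blocks.driftFun_inr, hεdef]
      push_cast
      linarith
  have hP := hD.stochastic
  have hdown : ∀ x y, D.P x y ≠ 0 → V x - (1 + ∑ i, a i) ≤ V y := fun x y h =>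
    MG1Blocks.driftFun_sub_le ha h
  have hQ : ∀ N, 1 ≤ N → IsStochastic (D.trunc N).P := fun N hN =>
    MG1Blocks.isStochastic_trunc hP hN
  have hdownQ : ∀ N x y, (D.trunc N).P x y ≠ 0 → V x - (1 + ∑ i, a i) ≤ V y := fun N x y h =>
    MG1Blocks.driftFun_sub_le ha h
  have htrunc : ∀ N, 1 ≤ N → ∃ H : MG1State M₀ M₁ → ℝ,
      (∀ x, HasSum (fun y => (D.trunc N).P x y * V y) (H x)) ∧ ∀ x, H x - V x ≤ g x - ε := by
    intro N hN
    choose H hH hH' using fun x =>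
      MG1Blocks.exists_hasSum_trunc_le hP hN x (MG1Blocks.driftFun_mono a) (hG x)
    exact ⟨H, hH', fun x => by simp only [g]; linarith [hH x]⟩
  have hexists : ∀ N : ℕ, 1 ≤ N → ∃ πN, IsStationaryDist (D.trunc N).P πN := by
    intro N hN
    obtain ⟨H, hH, hH'⟩ := htrunc N hN
    exact (hQ N hN).exists_stationaryDist hδ hV hH (hdownQ N) hε hH' hg
  have hlow : ∀ N, 1 ≤ N → ∀ μ, IsStationaryDist (D.trunc N).P μ → ε ≤ ∑ x ∈ C, μ x * g x := by
    intro N hN μ hμ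
    obtain ⟨H, hH, hH'⟩ := htrunc N hN
    exact hμ.le_sum_of_drift (hQ N hN) hδ hV hH (hdownQ N) hε.le hH' hg
  obtain ⟨π, hπ⟩ := hP.exists_stationaryDist hδ hV hG hdown hε (fun x => by simp [g]) hg
  have hπε : ∑ x ∈ C, π x * g x = ε :=
    hπ.sum_eq_of_drift hP hδ hV hG hdown hε.le (fun x => by simp [g]) hg
  have hreach := hD.irreducible.reflTransGen
  have huniq : ∀ π', IsStationaryDist D.P π' → π' = π := fun π' hπ' =>
    hP.stationaryDist_unique (z := z) (fun μ hμ => by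
      obtain ⟨x, hx⟩ : ∃ x, 0 < μ x := by
        by_contra! h
        have := hasSum_le h hμ.2.1 hasSum_zero
        linarith
      exact hμ.pos_of_reachable hP hx (hreach x z)) hπ' hπ
  have hreachQ : ∀ᶠ N : ℕ in atTop, ∀ x ∈ C,
      Relation.ReflTransGen (fun x y => 0 < (D.trunc N).P x y) x z := by
    -- A path in `P` has finitely many edges, each unchanged by truncation at all large `N`;
    -- finiteness of `C` makes the threshold uniform.
    refine (Filter.eventually_all_finset C).2 fun x _ => ?_
    generalize z = y
    induction hreach x y with
    | refl => exact .of_forall fun N => .refl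
    | @tail b c _ hbc ih =>
      filter_upwards [ih, MG1Blocks.eventually_trunc_P_eq (D := D) b c] with N h1 h2
      exact h1.tail (by rwa [h2])
  refine ⟨π, ⟨hπ, huniq⟩, hexists, ?_, fun πN hπN => ?_⟩
  · filter_upwards [hreachQ, eventually_ge_atTop 1] with N hN hN1
    obtain ⟨μ, hμ⟩ := hexists N hN1
    refine ⟨μ, hμ, fun ν hν => (hQ N hN1).stationaryDist_unique (z := z) (fun μ hμ => ?_) hν hμ⟩
    obtain ⟨⟨x, hxC, hx⟩, -⟩ :=
      tsum_pos_of_sum_mul_pos hμ.1 hμ.2.1.summable hε (hlow N hN1 μ hμ)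
    exact hμ.pos_of_reachable (hQ N hN1) hx (hN x hxC)
  · have h1 := eventually_ge_atTop (α := ℕ) 1
    exact tendsto_tvNorm_stationaryDist hP hπ huniq (h1.mono hQ) (h1.mono hπN)
      (fun x y => tendsto_const_nhds.congr' ((MG1Blocks.eventually_trunc_P_eq x y).mono
        fun N h => h.symm)) hε hπε (h1.mono fun N hN => hlow N hN _ (hπN N hN))
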